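/- For $N\in\mathbb N$, let $\Omega_N^2$ be the set of all NOT, CNOT and C$^2$NOT gates on $N$ lines, i.e. of all maps $\mathbb B^N\to\mathbb B^N$, $\mathbb B=\{0,1\}$, that replace $x_t$ by $x_t\oplus\bigwedge_{i\in I}x_i$ and leave the other coordinates unchanged, where $I\subseteq\{1,\dots,N\}$, $|I|\le 2$, $t\notin I$ (the empty conjunction is $1$). A reversible circuit with $N$ inputs is a finite composition of gates from $\Omega_N^2$; its gate complexity is its number of gates. A circuit with $n+q$ inputs implements $f:\mathbb B^n\to\mathbb B^n$ (with $q$ additional inputs) if there is a permutation $\pi$ of its $n+q$ outputs such that, for every $x\in\mathbb B^n$, the circuit transforms the input $\langle x_1,\dots,x_n,0,\dots,0\rangle$ into an output whose first $n$ coordinates, after applying $\pi$, are $f(x)$ (the remaining $q$ coordinates being arbitrary). Let $F(n,q)$ be the set of all $f:\mathbb B^n\to\mathbb B^n$ implemented by some circuit with $n+q$ inputs, let $L(f,q)$ be the minimum gate complexity of a circuit with $n+q$ inputs implementing $f\in F(n,q)$, and let $$L(n,q)=\max_{f\in F(n,q)}L(f,q).$$ **Theorem.** Let $\varphi,\psi:\mathbb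 N\to\mathbb R$ be functions with $\varphi(n)\to\infty$ and $\psi(n)\to\infty$ as $n\to\infty$ (growing arbitrarily slowly) such that $\varphi(n)\le n/(\log_2 n+\log_2\psi(n))$ for all sufficiently large $n$, and let $q_0:\mathbb N\to\mathbb N$ satisfy $q_0(n)\sim n\,2^{\,n-\lceil n/\varphi(n)\rceil}$ as $n\to\infty$. Then $$L(n,q_0(n))\asymp 2^n ,$$ i.e. there are constants $c,C>0$ with $c\,2^n\le L(n,q_0(n))\le C\,2^n$ for all sufficiently large $n$. -/

import Mathlib

open Filter Asymptotics

namespace Reversible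

/-- A NOT, CNOT or C²NOT gate on `N` lines: a generalized Toffoli gate with at most two
control lines and a target line that is not a control line. -/
structure Gate (N : ℕ) where
  controls : Finset (Fin N)
  target : Fin N
  card_controls_le : controls.card ≤ 2
  target_notMem : target ∉ controls

/-- The transformation defined by a gate: the target line is XORed with the conjunction of
the control lines (the empty conjunction being `1`), the other lines are unchanged. -/
def Gate.apply {N : ℕ} (g : Gate N) (x : Fin N → Bool) : Fin N → Bool :=
  Function.update x g.target (xor (x g.target) (decide (∀ i ∈ g.controls, x i = true)))

/-- A reversible circuit with `N` inputs: a chain of gates, the head of the list acting first. -/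
abbrev Circuit (N : ℕ) : Type := List (Gate N)

/-- The gate complexity of a circuit: its number of gates. -/
def Circuit.gateCount {N : ℕ} (S : Circuit N) : ℕ := S.length

/-- The transformation defined by a circuit. -/
def Circuit.eval {N : ℕ} (S : Circuit N) (x : Fin N → Bool) : Fin N → Bool :=
  S.foldl (fun y g => g.apply y) x

/-- The circuit `S` with `n + q` inputs implements `f` with `q` additional inputs: for some
permutation `π` of the outputs, every input `⟨x₁, …, xₙ, 0, …, 0⟩` is transformed into an output
which, after applying `π`, has `f x` as its first `n` entries (the others are arbitrary). -/
def Circuit.Implements {n q : ℕ} (S : Circuit (n + q))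
    (f : (Fin n → Bool) → (Fin n → Bool)) : Prop :=
  ∃ π : Equiv.Perm (Fin (n + q)), ∀ (x : Fin n → Bool) (i : Fin n),
    S.eval (Fin.append x (fun _ : Fin q => false)) (π (Fin.castAdd q i)) = f x i

/-- `F(n, q)`: the transformations of `𝔹ⁿ` that are implemented by circuits with `n + q` inputs. -/
def F (n q : ℕ) : Set ((Fin n → Bool) → (Fin n → Bool)) :=
  {f | ∃ S : Circuit (n + q), S.Implements f}

/-- `L(f, q)`: the minimum gate complexity of a circuit implementing `f` with `q` additional
inputs (meaningful for `f ∈ F n q`). -/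
noncomputable def complexityOf {n : ℕ} (f : (Fin n → Bool) → (Fin n → Bool)) (q : ℕ) : ℕ :=
  sInf {l | ∃ S : Circuit (n + q), S.Implements f ∧ S.gateCount = l}

open Classical in
/-- The Shannon gate complexity function `L(n, q)`, the maximum of `L(f, q)` over the finite set
of all `f ∈ F(n, q)`. -/
noncomputable def L (n q : ℕ) : ℕ :=
  (Finset.univ.filter (fun f : (Fin n → Bool) → (Fin n → Bool) => f ∈ F n q)).sup
    (fun f => complexityOf f q)

end Reversible

/-! Upper bound: split the variables into blocks of sizes `a`, `n / 2` and `r`, with `2 ^ r` between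
`n / 8` and `n / 4`. Precompute the minterms of the first two blocks and all products (minterm of
the second) · (function of the third); this takes `O(2 ^ (3 * n / 4))` lines and gates. By Shannon
expansion each output is a XOR of `2 ^ (a + n / 2) < 8 * 2 ^ n / n` products of precomputed
functions, so all `n` outputs cost `O(2 ^ n)` gates (`exists_implements`).

Lower bound: with `2 ^ O(n)` lines there are `2 ^ O(n)` gates, while there are `2 ^ (n * 2 ^ n)`
maps; counting circuits forces length of order `2 ^ n` (`le_L`).

Since `φ → ∞`, `q₀ n` lies between the two line bounds needed (`eventually_bounds`). -/

namespace Reversible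

/-! ### XOR sums of products -/

/-- `XorSum A B t f`: the function `f` is a XOR of at most `t` products of a member of `A` and a
member of `B`. -/
inductive XorSum {X : Type*} (A B : Set (X → Bool)) : ℕ → (X → Bool) → Prop
  | zero (t : ℕ) : XorSum A B t (fun _ => false)
  | add {t : ℕ} {f a b : X → Bool} (hf : XorSum A B t f) (ha : a ∈ A) (hb : b ∈ B) :
      XorSum A B (t + 1) (fun x => xor (f x) (a x && b x))

namespace XorSum

variable {X : Type*} {A B A' B' : Set (X → Bool)} {s t : ℕ} {f g : X → Bool}

theorem mono (hA : A ⊆ A') (hB : B ⊆ B') (h : XorSum A B t f) : XorSum A' B' t f := by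
  induction h with
  | zero t => exact zero t
  | add _ ha hb ih => exact ih.add (hA ha) (hB hb)

theorem mono_length (h : XorSum A B s f) (hst : s ≤ t) : XorSum A B t f := by
  induction h generalizing t with
  | zero s => exact zero t
  | add _ ha hb ih =>
    obtain ⟨t, rfl⟩ : ∃ u, t = u + 1 := ⟨t - 1, by omega⟩
    exact (ih (by omega)).add ha hb

theorem xor (hf : XorSum A B s f) (hg : XorSum A B t g) :
    XorSum A B (s + t) (fun x => Bool.xor (f x) (g x)) := by
  induction hg with
  | zero t => simpa using hf.mono_length (Nat.le_add_right s t)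
  | add _ ha hb ih => simpa [Bool.xor_assoc, ← add_assoc] using ih.add ha hb

theorem single {a b : X → Bool} (ha : a ∈ A) (hb : b ∈ B) :
    XorSum A B 1 (fun x => a x && b x) := by
  simpa using (zero 0).add ha hb

/-- Multiplying a sum of products by a fixed function. -/
theorem mul_left (c : X → Bool) (hc : ∀ a ∈ A, (fun x => c x && a x) ∈ A')
    (h : XorSum A B t f) : XorSum A' B t (fun x => c x && f x) := by
  induction h with
  | zero t => simpa using zero t
  | add _ ha hb ih =>
    simpa [Bool.and_xor_distrib_left, Bool.and_assoc] using ih.add (hc _ ha) hb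

/-- Substituting sums of products for the second factors. -/
theorem bind {C D E : Set (X → Bool)} (h : XorSum A B t f)
    (hB : ∀ b ∈ B, XorSum C D s b)
    (hE : ∀ c ∈ C, ∀ d ∈ D, (fun x => c x && d x) ∈ E) :
    XorSum A E (t * s) f := by
  induction h with
  | zero t => exact zero _
  | @add t f a b _ ha hb hf =>
    rw [Nat.succ_mul]
    refine hf.xor ?_
    replace hB := hB b hb
    clear hf hb
    induction hB with
    | zero t => simpa using zero t
    | add _ hc hd ih =>
      simpa [Bool.and_xor_distrib_left] using ih.add ha (hE _ hc _ hd)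

end XorSum

/-! ### From straight-line computations to reversible circuits -/

/-- The Boolean functions of `n` variables. -/
abbrev BoolFn (n : ℕ) : Type := (Fin n → Bool) → Bool

/-- `Chain g vs`: starting from the input variables, the functions in the list `vs` can be
computed one after another, each on a new line, by `g` gates in total. -/
inductive Chain {n : ℕ} : ℕ → List (BoolFn n) → Prop
  | inputs : Chain 0 (List.ofFn fun i x => x i)
  -- A NOT gate is needed: sums of products of inputs all vanish at the zero input.
  | one {g : ℕ} {vs : List (BoolFn n)} (h : Chain g vs) : Chain (g + 1) (vs ++ [fun _ => true])
  | snoc {g t : ℕ} {vs : List (BoolFn n)} {f : BoolFn n} (h : Chain g vs)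
      (hf : XorSum {a | a ∈ vs} {a | a ∈ vs} t f) : Chain (g + t) (vs ++ [f])

variable {n : ℕ}

theorem Chain.append {g t : ℕ} {vs : List (BoolFn n)} (h : Chain g vs) (fs : List (BoolFn n))
    (hfs : ∀ f ∈ fs, XorSum {a | a ∈ vs} {a | a ∈ vs} t f) :
    Chain (g + fs.length * t) (vs ++ fs) := by
  induction fs using List.reverseRecOn with
  | nil => simpa using h
  | append_singleton fs f ih =>
    have h1 := ih fun f hf => hfs f (by simp [hf])
    have h2 := h1.snoc ((hfs f (by simp)).mono
      (A' := {a | a ∈ vs ++ fs}) (B' := {a | a ∈ vs ++ fs})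
      (fun a ha => List.mem_append_left _ ha) (fun a ha => List.mem_append_left _ ha))
    simpa [Nat.succ_mul, add_assoc] using h2

theorem Circuit.eval_concat {N : ℕ} (S : Circuit N) (g : Gate N) (x : Fin N → Bool) :
    Circuit.eval (S ++ [g]) x = g.apply (Circuit.eval S x) := by
  simp [Circuit.eval, List.foldl_append]

/-- The circuit `S` computes the functions `vs` on its first lines and keeps the others zero. -/
def Computes {q : ℕ} (S : Circuit (n + q)) (vs : List (BoolFn n)) : Prop :=
  ∀ (x : Fin n → Bool) (i : Fin (n + q)),
    S.eval (Fin.append x fun _ => false) i = vs.getD i (fun _ => false) x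

/-- One gate per product, all aimed at the first unused line. The factors sit on earlier lines,
which stay intact; equal factors give a CNOT. -/
theorem Computes.exists_update {q t : ℕ} {S : Circuit (n + q)} {vs : List (BoolFn n)}
    (hS : Computes S vs) (hvs : vs.length < n + q) {f : BoolFn n}
    (hf : XorSum {a | a ∈ vs} {a | a ∈ vs} t f) :
    ∃ T : Circuit (n + q), T.length ≤ t ∧ ∀ x : Fin n → Bool,
      Circuit.eval (S ++ T) (Fin.append x fun _ => false) =
        Function.update (S.eval (Fin.append x fun _ => false)) ⟨vs.length, hvs⟩ (f x) := by
  induction hf with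
  | zero t =>
    refine ⟨[], by simp, fun x => ?_⟩
    rw [List.append_nil]
    refine (Function.update_eq_self_iff.mpr ?_).symm
    simp [hS x]
  | @add t f a b _ ha hb ih =>
    obtain ⟨T, hT, hT'⟩ := ih
    obtain ⟨i, hi, rfl⟩ := List.mem_iff_getElem.mp ha
    obtain ⟨j, hj, rfl⟩ := List.mem_iff_getElem.mp hb
    have hmem : (⟨vs.length, hvs⟩ : Fin (n + q)) ∉
        ({⟨i, hi.trans hvs⟩, ⟨j, hj.trans hvs⟩} : Finset (Fin (n + q))) := by
      simp only [Finset.mem_insert, Finset.mem_singleton, Fin.mk.injEq]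
      omega
    refine ⟨T ++ [⟨_, _, Finset.card_le_two, hmem⟩], by simpa using hT, fun x => ?_⟩
    have h1 := hS x ⟨i, hi.trans hvs⟩
    have h2 := hS x ⟨j, hj.trans hvs⟩
    simp only [List.getD_eq_getElem _ _ hi, List.getD_eq_getElem _ _ hj] at h1 h2
    rw [← List.append_assoc, Circuit.eval_concat, hT', Gate.apply]
    simp only [Function.update_self, Function.update_idem, Finset.mem_insert,
      Finset.mem_singleton, forall_eq_or_imp, forall_eq]
    rw [Function.update_of_ne (by simp; omega), Function.update_of_ne (by simp; omega), h1, h2]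
    simp

theorem Computes.append_singleton {q : ℕ} {S T : Circuit (n + q)} {vs : List (BoolFn n)}
    (hS : Computes S vs) (hvs : vs.length < n + q) {f : BoolFn n}
    (hT : ∀ x : Fin n → Bool,
      Circuit.eval (S ++ T) (Fin.append x fun _ => false) =
        Function.update (S.eval (Fin.append x fun _ => false)) ⟨vs.length, hvs⟩ (f x)) :
    Computes (S ++ T) (vs ++ [f]) := by
  intro x i
  rw [hT x]
  rcases lt_trichotomy (i : ℕ) vs.length with h | h | h
  · rw [Function.update_of_ne (by simp [Fin.ext_iff]; omega), hS x i,
      List.getD_append _ _ _ _ h]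
  · obtain rfl : i = ⟨vs.length, hvs⟩ := Fin.ext h
    simp
  · rw [Function.update_of_ne (by simp [Fin.ext_iff]; omega), hS x i,
      List.getD_eq_default _ _ h.le, List.getD_eq_default _ _ (by simpa using h)]

theorem Chain.exists_computes {g q : ℕ} {vs : List (BoolFn n)} (h : Chain g vs)
    (hq : vs.length ≤ n + q) :
    ∃ S : Circuit (n + q), S.length ≤ g ∧ Computes S vs := by
  induction h with
  | inputs =>
    refine ⟨[], by simp, fun x i => ?_⟩
    refine Fin.addCases (fun i => ?_) (fun i => ?_) i
    · simp [Circuit.eval]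
    · simp [Circuit.eval]
  | @one g vs h ih =>
    rw [List.length_append, List.length_singleton] at hq
    obtain ⟨S, hS, hS'⟩ := ih (by omega)
    refine ⟨S ++ [⟨∅, ⟨vs.length, hq⟩, by simp, by simp⟩], by simpa using hS,
      hS'.append_singleton hq fun x => ?_⟩
    rw [Circuit.eval_concat, Gate.apply, hS' x ⟨vs.length, hq⟩]
    simp
  | @snoc g t vs f h hf ih =>
    rw [List.length_append, List.length_singleton] at hq
    obtain ⟨S, hS, hS'⟩ := ih (by omega)
    obtain ⟨T, hT, hT'⟩ := hS'.exists_update hq hf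
    exact ⟨S ++ T, by rw [List.length_append]; omega, hS'.append_singleton hq hT'⟩

theorem Computes.implements {q : ℕ} {S : Circuit (n + q)} {vs : List (BoolFn n)}
    {f : (Fin n → Bool) → (Fin n → Bool)}
    (hS : Computes S (vs ++ List.ofFn fun j x => f x j)) (hq : vs.length ≤ q) :
    S.Implements f := by
  let e₁ : Fin n ↪ Fin (n + q) := Fin.castAddEmb q
  let e₂ : Fin n ↪ Fin (n + q) :=
    ⟨fun j => ⟨vs.length + j, by omega⟩, fun i j h => by simpa [Fin.ext_iff] using h⟩
  -- The symmetric group is `n`-transitive, so some `π` sends the first `n` positions to the lines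
  -- holding the outputs.
  obtain ⟨π, hπ⟩ := (Equiv.Perm.isMultiplyPretransitive (Fin (n + q)) n).exists_smul_eq e₁ e₂
  refine ⟨π, fun x i => ?_⟩
  have h1 : π (Fin.castAdd q i) = ⟨vs.length + i, by omega⟩ := DFunLike.congr_fun hπ i
  rw [h1, hS x]
  simp

/-! ### Precomputed functions -/

/-- The list `vs` of functions can be computed by a chain with at most three gates per line. -/
def Cheap (vs : List (BoolFn n)) : Prop := ∃ g, g ≤ 3 * vs.length ∧ Chain g vs

theorem Cheap.append {t : ℕ} {vs : List (BoolFn n)} (h : Cheap vs) (ht : t ≤ 3)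
    (fs : List (BoolFn n)) (hfs : ∀ f ∈ fs, XorSum {a | a ∈ vs} {a | a ∈ vs} t f) :
    Cheap (vs ++ fs) := by
  obtain ⟨g, hg, h⟩ := h
  refine ⟨_, ?_, h.append fs hfs⟩
  rw [List.length_append]
  nlinarith

theorem cheap_inputs_one : Cheap ((List.ofFn fun i (x : Fin n → Bool) => x i) ++ [fun _ => true]) :=
  ⟨0 + 1, by simp; omega, Chain.inputs.one⟩

/-- The indicators of all the assignments of values to the variables in `l`. -/
def monomials : List (Fin n) → List (BoolFn n)
  | [] => [fun _ => true]
  | i :: l => (monomials l).map (fun m x => x i && m x) ++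
      (monomials l).map (fun m x => !x i && m x)

theorem length_monomials (l : List (Fin n)) : (monomials l).length = 2 ^ l.length := by
  induction l with
  | nil => rfl
  | cons i l ih => simp [monomials, ih, pow_succ, mul_two]

theorem Cheap.exists_monomials {vs : List (BoolFn n)} (h : Cheap vs)
    (hi : ∀ i : Fin n, (fun x => x i) ∈ vs) (h1 : (fun _ => true) ∈ vs) (l : List (Fin n)) :
    ∃ ws : List (BoolFn n), Cheap (vs ++ ws) ∧ ws.length ≤ 2 * 2 ^ l.length ∧
      ∀ m ∈ monomials l, m ∈ vs ++ ws := by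
  induction l with
  | nil => exact ⟨[], by simpa using h, by simp, by simpa [monomials] using h1⟩
  | cons i l ih =>
    obtain ⟨ws, hw, hlen, hmem⟩ := ih
    have hx : (fun x : Fin n → Bool => x i) ∈ vs ++ ws := List.mem_append_left _ (hi i)
    have ht : (fun _ : Fin n → Bool => true) ∈ vs ++ ws := List.mem_append_left _ h1
    refine ⟨ws ++ monomials (i :: l), ?_, ?_, fun m hm => by simp [hm]⟩
    · rw [← List.append_assoc]
      refine hw.append (t := 2) (by norm_num) _ fun f hf => ?_
      rw [monomials, List.mem_append, List.mem_map, List.mem_map] at hf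
      rcases hf with ⟨m, hm, rfl⟩ | ⟨m, hm, rfl⟩
      · exact (XorSum.single hx (hmem m hm)).mono_length (by norm_num)
      -- `¬x ∧ m = m ⊕ (x ∧ m)`, with `m` written as `1 ∧ m`.
      · convert (XorSum.single (A := {a | a ∈ vs ++ ws}) (B := {a | a ∈ vs ++ ws}) ht
          (hmem m hm)).add hx (hmem m hm) using 2 with x
        cases x i <;> cases m x <;> rfl
    · rw [List.length_append, length_monomials, List.length_cons, pow_succ]
      omega

/-- All the functions of the variables in `l`. -/
def allFns : List (Fin n) → List (BoolFn n)
  | [] => [fun _ => false, fun _ => true]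
  | i :: l => (allFns l).flatMap fun g => (allFns l).map fun h x => bif x i then g x else h x

theorem length_allFns (l : List (Fin n)) : (allFns l).length = 2 ^ 2 ^ l.length := by
  induction l with
  | nil => rfl
  | cons i l ih => simp [allFns, ih, pow_succ, pow_mul]

theorem Cheap.exists_allFns {vs : List (BoolFn n)} (h : Cheap vs)
    (hi : ∀ i : Fin n, (fun x => x i) ∈ vs) (h1 : (fun _ => true) ∈ vs) (l : List (Fin n)) :
    ∃ ws : List (BoolFn n), Cheap (vs ++ ws) ∧ ws.length ≤ 2 * 2 ^ 2 ^ l.length ∧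
      ∀ m ∈ allFns l, m ∈ vs ++ ws := by
  induction l with
  | nil =>
    refine ⟨[fun _ => false], h.append (t := 0) (by norm_num) _ ?_, by simp, ?_⟩
    · simpa using XorSum.zero 0
    · simp [allFns, h1]
  | cons i l ih =>
    obtain ⟨ws, hw, hlen, hmem⟩ := ih
    have hx : (fun x : Fin n → Bool => x i) ∈ vs ++ ws := List.mem_append_left _ (hi i)
    have ht : (fun _ : Fin n → Bool => true) ∈ vs ++ ws := List.mem_append_left _ h1
    refine ⟨ws ++ allFns (i :: l), ?_, ?_, fun m hm => by simp [hm]⟩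
    · rw [← List.append_assoc]
      refine hw.append le_rfl _ fun f hf => ?_
      simp only [allFns, List.mem_flatMap, List.mem_map] at hf
      obtain ⟨g, hg, h, hh, rfl⟩ := hf
      -- The multiplexer is `h ⊕ xh ⊕ xg`, whence the three gates per line in `Cheap`.
      convert ((XorSum.single (A := {a | a ∈ vs ++ ws}) (B := {a | a ∈ vs ++ ws}) ht
        (hmem h hh)).add hx (hmem h hh)).add hx (hmem g hg) using 2 with x
      cases x i <;> cases g x <;> cases h x <;> rfl
    · rw [List.length_append, length_allFns, List.length_cons, pow_succ, pow_mul, sq]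
      have : 2 ≤ 2 ^ 2 ^ l.length := Nat.le_self_pow (by positivity) 2
      nlinarith

theorem dependsOn_update {f : BoolFn n} {i : Fin n} {l : List (Fin n)}
    (hf : DependsOn f {j | j ∈ i :: l}) (b : Bool) :
    DependsOn (fun x => f (Function.update x i b)) {j | j ∈ l} := by
  intro x y hxy
  refine hf fun j hj => ?_
  by_cases h : j = i
  · subst h; simp
  · rw [Function.update_of_ne h, Function.update_of_ne h]
    exact hxy j (by simpa [h] using hj)

theorem mem_allFns {l : List (Fin n)} {f : BoolFn n} (hf : DependsOn f {j | j ∈ l}) :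
    f ∈ allFns l := by
  induction l generalizing f with
  | nil =>
    have : f = fun _ => f fun _ => false := by
      ext x
      rw [hf (y := fun _ => false) (by simp)]
    rw [this]
    cases f fun _ => false <;> simp [allFns]
  | cons i l ih =>
    simp only [allFns, List.mem_flatMap, List.mem_map]
    refine ⟨_, ih (dependsOn_update hf true), _, ih (dependsOn_update hf false), ?_⟩
    ext x
    nth_rw 4 [← Function.update_eq_self i x]
    cases x i <;> rfl

/-! ### Shannon expansion and the upper bound -/

/-- The Shannon expansion with respect to the variables in `l`. -/
theorem xorSum_monomials {l r : List (Fin n)} {f : BoolFn n} (hf : DependsOn f {j | j ∈ l ++ r}) :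
    XorSum {m | m ∈ monomials l} {g | DependsOn g {j | j ∈ r}} (2 ^ l.length) f := by
  induction l generalizing f with
  | nil =>
    have h1 : (fun _ => true) ∈ {m | m ∈ monomials ([] : List (Fin n))} := by simp [monomials]
    have h2 : f ∈ {g | DependsOn g {j | j ∈ r}} := hf
    simpa using XorSum.single h1 h2
  | cons i l ih =>
    have h1 := (ih (dependsOn_update hf true)).mul_left (A' := {m | m ∈ monomials (i :: l)})
      (fun x => x i) (fun a ha => by
        simp only [monomials, Set.mem_ofPred_eq, List.mem_append, List.mem_map]
        exact Or.inl ⟨a, ha, rfl⟩)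
    have h0 := (ih (dependsOn_update hf false)).mul_left (A' := {m | m ∈ monomials (i :: l)})
      (fun x => !x i) (fun a ha => by
        simp only [monomials, Set.mem_ofPred_eq, List.mem_append, List.mem_map]
        exact Or.inr ⟨a, ha, rfl⟩)
    rw [List.length_cons, pow_succ, mul_two]
    convert h1.xor h0 using 2 with x
    nth_rw 1 [← Function.update_eq_self i x]
    cases x i <;> simp

/-- A circuit for an arbitrary map, from a partition of the variables into three blocks. -/
theorem exists_implements_of_blocks {q : ℕ} (f : (Fin n → Bool) → (Fin n → Bool))
    (l₂ l₁ l₀ : List (Fin n)) (hl : ∀ i, i ∈ l₂ ++ (l₁ ++ l₀))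
    (hq : n + 1 + 2 * 2 ^ l₂.length + 2 * 2 ^ l₁.length + 2 * 2 ^ 2 ^ l₀.length
      + 2 ^ l₁.length * 2 ^ 2 ^ l₀.length ≤ q) :
    ∃ S : Circuit (n + q), S.Implements f ∧
      S.length ≤ 3 * (n + 1 + 2 * 2 ^ l₂.length + 2 * 2 ^ l₁.length + 2 * 2 ^ 2 ^ l₀.length
        + 2 ^ l₁.length * 2 ^ 2 ^ l₀.length) + n * (2 ^ l₂.length * 2 ^ l₁.length) := by
  have h0 := cheap_inputs_one (n := n)
  set v₀ : List (BoolFn n) := (List.ofFn fun i x => x i) ++ [fun _ => true] with hv₀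
  have hlen₀ : v₀.length = n + 1 := by simp [hv₀]
  have hi : ∀ i : Fin n, (fun x => x i) ∈ v₀ := fun i => by simp [hv₀, List.mem_ofFn]
  have ht : (fun _ => true) ∈ v₀ := by simp [hv₀]
  obtain ⟨w₂, hw₂, hlen₂, hm₂⟩ := h0.exists_monomials hi ht l₂
  have up : ∀ {a : BoolFn n} {v : List (BoolFn n)} (w), a ∈ v → a ∈ v ++ w :=
    fun w h => List.mem_append_left w h
  obtain ⟨w₁, hw₁, hlen₁, hm₁⟩ := hw₂.exists_monomials (fun i => up _ (hi i)) (up _ ht) l₁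
  obtain ⟨w, hw, hlen, hm⟩ :=
    hw₁.exists_allFns (fun i => up _ (up _ (hi i))) (up _ (up _ ht)) l₀
  set p : List (BoolFn n) :=
    (monomials l₁).flatMap fun m => (allFns l₀).map fun g x => m x && g x with hp
  have hplen : p.length = 2 ^ l₁.length * 2 ^ 2 ^ l₀.length := by
    simp [hp, length_monomials, length_allFns]
  obtain ⟨g, hg, hc⟩ := hw.append (t := 1) (by norm_num) p fun f hf => by
    simp only [hp, List.mem_flatMap, List.mem_map] at hf
    obtain ⟨m, hm', g, hg, rfl⟩ := hf
    exact XorSum.single (up _ (hm₁ m hm')) (hm g hg)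
  set v := v₀ ++ w₂ ++ w₁ ++ w ++ p with hv
  have hvlen : v.length ≤ n + 1 + 2 * 2 ^ l₂.length + 2 * 2 ^ l₁.length + 2 * 2 ^ 2 ^ l₀.length
      + 2 ^ l₁.length * 2 ^ 2 ^ l₀.length := by
    simp only [hv, List.length_append]
    omega
  have hout := hc.append (t := 2 ^ l₂.length * 2 ^ l₁.length) (List.ofFn fun j x => f x j) <| by
    intro F _
    have hF : DependsOn F {j | j ∈ l₂ ++ (l₁ ++ l₀)} := fun x y hxy => by
      rw [show x = y from funext fun i => hxy i (hl i)]
    -- Expand over `l₂`, then expand each coefficient over `l₁`; the inner products are exactly the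
    -- members of `p`.
    refine ((xorSum_monomials hF).bind (E := {a | a ∈ p}) (fun b hb => xorSum_monomials hb)
      fun c hc d hd => ?_).mono ?_ ?_
    · simp only [hp, Set.mem_ofPred_eq, List.mem_flatMap, List.mem_map]
      exact ⟨c, hc, d, mem_allFns hd, rfl⟩
    · exact fun a ha => up _ (up _ (up _ (hm₂ a ha)))
    · exact fun a ha => List.mem_append_right _ ha
  obtain ⟨S, hS, hS'⟩ := hout.exists_computes (q := q) (by simp; omega)
  refine ⟨S, hS'.implements (hvlen.trans hq), hS.trans ?_⟩
  rw [List.length_ofFn]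
  omega

/-- With exponentially few additional inputs every map is implemented by `O(2 ^ n)` gates. -/
theorem exists_implements {q : ℕ} (hn : 4 ≤ n) (hq : 16 * 2 ^ (3 * n / 4) ≤ q)
    (f : (Fin n → Bool) → (Fin n → Bool)) :
    ∃ S : Circuit (n + q), S.Implements f ∧ S.length ≤ 56 * 2 ^ n := by
  have hlog : 2 ≤ Nat.log 2 n := Nat.le_log_of_pow_le (by norm_num) hn
  obtain ⟨r, hr⟩ : ∃ r, Nat.log 2 n = r + 2 := ⟨Nat.log 2 n - 2, by omega⟩
  have hr1 : 2 ^ r * 4 ≤ n := by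
    have := Nat.pow_log_le_self 2 (x := n) (by omega)
    rwa [hr, pow_add] at this
  have hr2 : n < 2 ^ r * 8 := by
    have := Nat.lt_pow_succ_log_self (b := 2) (by norm_num) n
    rwa [hr, Nat.succ_eq_add_one, add_assoc, pow_add] at this
  have hr3 : r < 2 ^ r := Nat.lt_two_pow_self
  obtain ⟨a, ha⟩ : ∃ a, a + n / 2 + r = n := ⟨n - n / 2 - r, by omega⟩
  let l := List.finRange n
  have hl2 : (l.take a).length = a := by simp [l]; omega
  have hl1 : ((l.drop a).take (n / 2)).length = n / 2 := by simp [l]; omega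
  have hl0 : ((l.drop a).drop (n / 2)).length = r := by simp [l]; omega
  have key := exists_implements_of_blocks (q := q) f (l.take a) ((l.drop a).take (n / 2))
    ((l.drop a).drop (n / 2)) (fun i => by
      rw [List.take_append_drop, List.take_append_drop]
      exact List.mem_finRange i)
  rw [hl2, hl1, hl0] at key
  set T := 2 ^ (3 * n / 4) with hT
  have b1 : 2 ^ (n / 2) ≤ T := Nat.pow_le_pow_right (by norm_num) (by omega)
  have b2 : 2 ^ a ≤ 2 * T := by
    rw [hT, ← pow_succ']
    exact Nat.pow_le_pow_right (by norm_num) (by omega)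
  have b3 : 2 ^ 2 ^ r ≤ T := Nat.pow_le_pow_right (by norm_num) (by omega)
  have b4 : 2 ^ (n / 2) * 2 ^ 2 ^ r ≤ T := by
    rw [← pow_add]
    exact Nat.pow_le_pow_right (by norm_num) (by omega)
  have b5 : n / 2 < 2 ^ (n / 2) := Nat.lt_two_pow_self
  have hM : n + 1 + 2 * 2 ^ a + 2 * 2 ^ (n / 2) + 2 * 2 ^ 2 ^ r + 2 ^ (n / 2) * 2 ^ 2 ^ r
      ≤ 16 * T := by omega
  obtain ⟨S, hS, hlen⟩ := key (hM.trans hq)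
  refine ⟨S, hS, hlen.trans ?_⟩
  have b6 : T ≤ 2 ^ n := Nat.pow_le_pow_right (by norm_num) (by omega)
  have b7 : n * (2 ^ a * 2 ^ (n / 2)) ≤ 8 * 2 ^ n := by
    calc n * (2 ^ a * 2 ^ (n / 2)) ≤ 2 ^ r * 8 * (2 ^ a * 2 ^ (n / 2)) := by gcongr
      _ = 8 * 2 ^ (a + n / 2 + r) := by ring
      _ = 8 * 2 ^ n := by rw [ha]
  -- `56 = 3 * 16 + 8`: precomputation, then outputs.
  omega

theorem exists_implements_gateCount_le_L {q : ℕ} {f : (Fin n → Bool) → (Fin n → Bool)}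
    (hf : f ∈ F n q) : ∃ S : Circuit (n + q), S.Implements f ∧ S.gateCount ≤ L n q := by
  obtain ⟨S, hS⟩ := hf
  obtain ⟨T, hT, hT'⟩ := Nat.sInf_mem (s := {l | ∃ S : Circuit (n + q), S.Implements f ∧
    S.gateCount = l}) ⟨_, S, hS, rfl⟩
  refine ⟨T, hT, ?_⟩
  rw [hT']
  classical
  exact Finset.le_sup (f := fun f => complexityOf f q)
    (Finset.mem_filter.mpr ⟨Finset.mem_univ f, S, hS⟩)

theorem L_le {q : ℕ} (hn : 4 ≤ n) (hq : 16 * 2 ^ (3 * n / 4) ≤ q) : L n q ≤ 56 * 2 ^ n := by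
  refine Finset.sup_le fun f _ => ?_
  obtain ⟨S, hS, hlen⟩ := exists_implements hn hq f
  have hle : complexityOf f q ≤ S.gateCount := Nat.sInf_le ⟨S, hS, rfl⟩
  exact hle.trans hlen

/-! ### Counting and the lower bound -/

theorem Gate.exists_code {N : ℕ} (g : Gate N) :
    ∃ p : Fin N × Fin N, g.controls = ({p.1, p.2} : Finset (Fin N)).erase g.target := by
  have ht := g.target_notMem
  have hc := g.card_controls_le
  obtain h | h | h : g.controls.card = 0 ∨ g.controls.card = 1 ∨ g.controls.card = 2 := by omega
  · rw [Finset.card_eq_zero] at h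
    exact ⟨(g.target, g.target), by simp [h]⟩
  · obtain ⟨a, ha⟩ := Finset.card_eq_one.mp h
    rw [ha] at ht
    exact ⟨(a, a), by simp [ha, Finset.erase_eq_of_notMem ht]⟩
  · obtain ⟨a, b, -, hab⟩ := Finset.card_eq_two.mp h
    rw [hab] at ht
    exact ⟨(a, b), by simp [hab, Finset.erase_eq_of_notMem ht]⟩

theorem Gate.exists_injective (N : ℕ) :
    ∃ c : Gate N → (Fin N × Fin N) × Fin N, Function.Injective c := by
  choose p hp using fun g : Gate N => g.exists_code
  refine ⟨fun g => (p g, g.target), fun g h hgh => ?_⟩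
  obtain ⟨h1, h2⟩ := Prod.ext_iff.mp hgh
  dsimp only at h1 h2
  have h3 : g.controls = h.controls := by rw [hp g, hp h, h1, h2]
  cases g
  cases h
  simp_all

noncomputable instance (N : ℕ) : Fintype (Gate N) :=
  Fintype.ofInjective _ (Gate.exists_injective N).choose_spec

theorem card_gate_le (N : ℕ) : Fintype.card (Gate N) ≤ N ^ 3 := by
  have := Fintype.card_le_of_injective _ (Gate.exists_injective N).choose_spec
  simp only [Fintype.card_prod, Fintype.card_fin] at this
  linarith

/-- Counting circuits: if `ℓ` gates suffice for all maps then `ℓ` is large. -/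
theorem card_le_of_forall_exists {q ℓ : ℕ}
    (h : ∀ f : (Fin n → Bool) → (Fin n → Bool),
      ∃ S : Circuit (n + q), S.Implements f ∧ S.gateCount ≤ ℓ) :
    2 ^ (n * 2 ^ n) ≤ ((n + q) ^ 3 + 1) ^ ℓ * (n + q) ^ n := by
  -- `none` pads shorter circuits, and only the positions of the `n` outputs matter, not the whole
  -- permutation.
  let decode : List.Vector (Option (Gate (n + q))) ℓ × (Fin n → Fin (n + q)) →
      ((Fin n → Bool) → (Fin n → Bool)) := fun p x i =>
    Circuit.eval p.1.1.reduceOption (Fin.append x fun _ => false) (p.2 i)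
  have hsurj : Function.Surjective decode := by
    intro f
    obtain ⟨S, ⟨π, hπ⟩, hS⟩ := h f
    refine ⟨(⟨S.map some ++ List.replicate (ℓ - S.length) none, ?_⟩,
      fun i => π (Fin.castAdd q i)), ?_⟩
    · have : S.length ≤ ℓ := hS
      simp; omega
    · funext x i
      rw [← hπ x i]
      simp [decode, List.reduceOption]
  have := Fintype.card_le_of_surjective _ hsurj
  simp only [Fintype.card_prod, Fintype.card_fun, card_vector, Fintype.card_option,
    Fintype.card_fin, Fintype.card_bool] at this
  rw [pow_mul]
  refine this.trans ?_
  gcongr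
  exact card_gate_le _

theorem le_L {q : ℕ} (hn : 5 ≤ n) (hq : 16 * 2 ^ (3 * n / 4) ≤ q) (hq' : n + q < 2 ^ (3 * n)) :
    2 ^ n ≤ 18 * L n q := by
  have h1 := card_le_of_forall_exists (n := n) (q := q) (ℓ := L n q) fun f =>
    exists_implements_gateCount_le_L <| by
      obtain ⟨S, hS, -⟩ := exists_implements (by omega) hq f
      exact ⟨S, hS⟩
  have h2 : (n + q) ^ 3 + 1 ≤ 2 ^ (9 * n) := by
    calc (n + q) ^ 3 + 1 ≤ (2 ^ (3 * n)) ^ 3 := Nat.pow_lt_pow_left hq' (by norm_num)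
      _ = 2 ^ (9 * n) := by rw [← pow_mul]; ring_nf
  have h3 : 2 ^ (n * 2 ^ n) ≤ 2 ^ (9 * n * L n q + 3 * n * n) := by
    rw [pow_add, pow_mul 2 (9 * n), pow_mul 2 (3 * n)]
    exact h1.trans (Nat.mul_le_mul (Nat.pow_le_pow_left h2 _) (Nat.pow_le_pow_left hq'.le _))
  have h4 := (Nat.pow_le_pow_iff_right (by norm_num)).mp h3
  have h5 : 2 ^ n ≤ 9 * L n q + 3 * n := by
    refine Nat.le_of_mul_le_mul_left (c := n) ?_ (by omega)
    linarith
  -- Absorbs `3 * n` into half of `2 ^ n`, turning `9` into `18`.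
  have h6 : 6 * n ≤ 2 ^ n := by
    clear * - hn
    induction n, hn using Nat.le_induction with
    | base => norm_num
    | succ n hn ih => rw [pow_succ]; omega
  omega

/-! ### Size of `q₀` and conclusion -/

theorem eventually_bounds {φ : ℕ → ℝ} {q₀ : ℕ → ℕ} (hφ : Tendsto φ atTop atTop)
    (hq₀ : (fun n : ℕ => (q₀ n : ℝ)) ~[atTop]
      (fun n : ℕ => (n : ℝ) * (2 : ℝ) ^ ((n : ℤ) - ⌈(n : ℝ) / φ n⌉))) :
    ∀ᶠ n in atTop, 5 ≤ n ∧ 16 * 2 ^ (3 * n / 4) ≤ q₀ n ∧ n + q₀ n < 2 ^ (3 * n) := by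
  -- `φ n ≥ 8` leaves an exponent of at least about `7 * n / 8`; `n ≥ 48` makes it exceed `3 * n / 4
  -- + 4` despite the roundings.
  filter_upwards [hq₀.isLittleO.def (c := 1 / 2) (by norm_num), hφ.eventually_ge_atTop 8,
    eventually_ge_atTop 48] with n h hφn hn
  have hn' : (48 : ℝ) ≤ n := by exact_mod_cast hn
  set e : ℤ := (n : ℤ) - ⌈(n : ℝ) / φ n⌉ with he
  have hpos : (0 : ℝ) < n * 2 ^ e := by positivity
  rw [Pi.sub_apply, Real.norm_eq_abs, Real.norm_eq_abs, abs_of_pos hpos, abs_le] at h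
  have hc0 : 0 ≤ ⌈(n : ℝ) / φ n⌉ := Int.ceil_nonneg (by positivity)
  have hc1 : ⌈(n : ℝ) / φ n⌉ ≤ (n : ℤ) / 8 + 1 := by
    have h8 : (n : ℝ) / φ n ≤ n / 8 := by gcongr
    rw [Int.ceil_le]
    refine h8.trans ?_
    have : (n : ℤ) ≤ 8 * ((n : ℤ) / 8 + 1) := by omega
    have : (n : ℝ) ≤ 8 * (((n : ℤ) / 8 + 1 : ℤ) : ℝ) := by exact_mod_cast this
    linarith
  refine ⟨by omega, ?_, ?_⟩
  · have h1 : (2 : ℝ) ^ (3 * n / 4 + 4) ≤ 2 ^ e := by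
      rw [← zpow_natCast]
      exact zpow_le_zpow_right₀ (by norm_num) (by push_cast; omega)
    have h2 : (16 * 2 ^ (3 * n / 4) : ℝ) ≤ q₀ n := by
      rw [pow_add] at h1
      nlinarith [h.1]
    exact_mod_cast h2
  · have h1 : (2 : ℝ) ^ e ≤ 2 ^ n := by
      rw [← zpow_natCast (2 : ℝ) n]
      exact zpow_le_zpow_right₀ (by norm_num) (by omega)
    have h2 : (q₀ n : ℝ) ≤ 2 * n * 2 ^ n := by nlinarith [h.2]
    have h2 : q₀ n ≤ 2 * n * 2 ^ n := by exact_mod_cast h2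
    have h3 : n < 2 ^ n := Nat.lt_two_pow_self
    have h4 : 4 ≤ 2 ^ n := by omega
    rw [mul_comm 3 n, pow_mul]
    nlinarith [Nat.mul_le_mul_right (2 ^ n * 2 ^ n) h4]

end Reversible

theorem mainTheorem2 (φ ψ : ℕ → ℝ) (q₀ : ℕ → ℕ)
    (hφ : Tendsto φ atTop atTop) (hψ : Tendsto ψ atTop atTop)
    (hφψ : ∀ᶠ n : ℕ in atTop,
      φ n ≤ (n : ℝ) / (Real.logb 2 (n : ℝ) + Real.logb 2 (ψ n)))
    (hq₀ : (fun n : ℕ => (q₀ n : ℝ)) ~[atTop]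
      (fun n : ℕ => (n : ℝ) * (2 : ℝ) ^ ((n : ℤ) - ⌈(n : ℝ) / φ n⌉))) :
    (fun n : ℕ => (Reversible.L n (q₀ n) : ℝ)) =Θ[atTop] (fun n : ℕ => (2 : ℝ) ^ n) := by
  have hev := Reversible.eventually_bounds hφ hq₀
  constructor
  · refine IsBigO.of_bound 56 ?_
    filter_upwards [hev] with n ⟨hn, hq, _⟩
    rw [Real.norm_of_nonneg (by positivity), Real.norm_of_nonneg (by positivity)]
    exact_mod_cast Reversible.L_le (by omega) hq
  · refine IsBigO.of_bound 18 ?_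
    filter_upwards [hev] with n ⟨hn, hq, hq'⟩
    rw [Real.norm_of_nonneg (by positivity), Real.norm_of_nonneg (by positivity)]
    exact_mod_cast Reversible.le_L hn hq hq'
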